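/- Let $X$ be a (finite-dimensional) complex manifold, for example a K\"ahler manifold, and let $\mathcal O_X$ be its sheaf of holomorphic functions. Let $\mathcal F$ be a locally free sheaf of $\mathcal O_X$-modules of finite rank and let $\mathcal G$ be a coherent sheaf of $\mathcal O_X$-modules. Then for every integer $q\ge 0$ there is an isomorphism of $\mathcal O_X(X)$-modules (in particular, of complex vector spaces) $$\operatorname{Ext}^q_{\mathcal O_X}(\mathcal F,\mathcal G)\;\cong\;H^q\bigl(X,\ \mathcal F^{\vee}\otimes_{\mathcal O_X}\mathcal G\bigr).$$ Here $\operatorname{Ext}^q_{\mathcal O_X}$ is the Ext group in the abelian category of sheaves of $\mathcal O_X$-modules, $\mathcal F^{\vee}=\mathcal Hom_{\mathcal O_X}(\mathcal F,\mathcal O_X)$ is the dual sheaf, and $H^q(X,-)$ is the $q$-th right derived functor of the global sections functor on sheaves of $\mathcal O_X$-modules. -/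

import Mathlib

open CategoryTheory Limits TopologicalSpace Opposite
open scoped Manifold ContDiff

universe u

namespace RingedSpaceModules

noncomputable section

section Grothendieck

variable {C : Type u} [SmallCategory C] {J : GrothendieckTopology C}

instance ab5OfSize_presheafOfModules (R : Cᵒᵖ ⥤ RingCat.{u}) :
    AB5OfSize.{u, u} (PresheafOfModules.{u} R) where
  ofShape K _ _ :=
    HasExactColimitsOfShape.domain_of_functor K (PresheafOfModules.toPresheaf R)

instance ab5OfSize_sheafOfModules (R : Sheaf J RingCat.{u}) :
    AB5OfSize.{u, u} (SheafOfModules.{u} R) where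
  ofShape K _ _ :=
    (PresheafOfModules.sheafificationAdjunction (𝟙 R.obj)).hasExactColimitsOfShape K

instance hasSeparator_sheafOfModules (R : Sheaf J RingCat.{u}) :
    HasSeparator (SheafOfModules.{u} R) where
  hasSeparator := ⟨_, ObjectProperty.IsSeparating.isSeparator_coproduct
    (f := fun X : C => (PresheafOfModules.sheafification (𝟙 R.obj)).obj
      ((PresheafOfModules.free R.obj).obj (yoneda.obj X))) (by
    intro M N f g h
    let adj := PresheafOfModules.sheafificationAdjunction (𝟙 R.obj)
    apply (SheafOfModules.forget R ⋙ PresheafOfModules.restrictScalars (𝟙 R.obj)).map_injective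
    apply PresheafOfModules.freeYoneda.isSeparating R.obj
    rintro _ ⟨X⟩ k
    have := h _ ⟨X⟩ ((adj.homEquiv _ _).symm k)
    rw [← Adjunction.homEquiv_naturality_right_symm,
      ← Adjunction.homEquiv_naturality_right_symm] at this
    exact (adj.homEquiv _ _).symm.injective this)⟩

/-- Sheaves of modules form a Grothendieck abelian category; in particular there are enough
injective sheaves of modules. -/
instance isGrothendieckAbelian_sheafOfModules (R : Sheaf J RingCat.{u}) :
    IsGrothendieckAbelian.{u} (SheafOfModules.{u} R) where

end Grothendieck

variable {X : Type u} [TopologicalSpace X]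

/-- A sheaf of commutative rings on `X`, regarded as a sheaf of rings. -/
abbrev ringCatSheaf (O : Sheaf (Opens.grothendieckTopology X) CommRingCat.{u}) :
    Sheaf (Opens.grothendieckTopology X) RingCat.{u} where
  obj := O.obj ⋙ forget₂ CommRingCat RingCat
  property := ((sheafCompose (Opens.grothendieckTopology X)
    (forget₂ CommRingCat.{u} RingCat.{u})).obj O).property

/-- The category of sheaves of `O`-modules on a ringed space `(X, O)`. -/
abbrev Modules (O : Sheaf (Opens.grothendieckTopology X) CommRingCat.{u}) : Type (u + 1) :=
  SheafOfModules.{u} (ringCatSheaf O)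

variable {O : Sheaf (Opens.grothendieckTopology X) CommRingCat.{u}}

/-- `M` is locally free of finite rank: `X` is covered by open sets on which `M` is isomorphic,
through finitely many sections, to a finite free module. The rank may vary. -/
def IsLocallyFreeOfFiniteRank (M : Modules O) : Prop :=
  ∃ q : SheafOfModules.LocalGeneratorsData.{u} M, q.IsLocallyFreeData ∧ q.IsFiniteType

/-- `M` is coherent: it is of finite type, and for every open set `U` the kernel of every
morphism from a finite free module to `M|_U` is of finite type. -/
structure IsCoherent (M : Modules O) : Prop where
  isFiniteType : M.IsFiniteType
  isFiniteType_kernel : ∀ (U : Opens X) (I : Type u) [Finite I]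
    (φ : SheafOfModules.free I ⟶ M.over U), (kernel φ).IsFiniteType

/-- Restriction of functions from `U` to `V ⊆ U`. -/
def resO (O : Sheaf (Opens.grothendieckTopology X) CommRingCat.{u}) {U V : Opens X} (h : V ≤ U) :
    O.obj.obj (op U) →+* O.obj.obj (op V) :=
  (O.obj.map (homOfLE h).op).hom

/-- Restriction of sections of an `O`-module from `U` to `V ⊆ U`. -/
def res (M : Modules O) {U V : Opens X} (h : V ≤ U) : M.val.obj (op U) →+ M.val.obj (op V) :=
  (M.val.presheaf.map (homOfLE h).op).hom

lemma resO_resO {U V W : Opens X} (h : V ≤ U) (k : W ≤ V) (r : O.obj.obj (op U)) :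
    resO O k (resO O h r) = resO O (k.trans h) r :=
  (ConcreteCategory.congr_hom (O.obj.map_comp (homOfLE h).op (homOfLE k).op) r).symm

lemma resO_refl {U : Opens X} (r : O.obj.obj (op U)) : resO O le_rfl r = r :=
  ConcreteCategory.congr_hom (O.obj.map_id (op U)) r

lemma res_res (M : Modules O) {U V W : Opens X} (h : V ≤ U) (k : W ≤ V) (m : M.val.obj (op U)) :
    res M k (res M h m) = res M (k.trans h) m :=
  (ConcreteCategory.congr_hom (M.val.presheaf.map_comp (homOfLE h).op (homOfLE k).op) m).symm

lemma res_smul (M : Modules O) {U V : Opens X} (h : V ≤ U) (r : O.obj.obj (op U))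
    (m : M.val.obj (op U)) : res M h (r • m) = resO O h r • res M h m :=
  M.val.map_smul (homOfLE h).op r m

/-- The `O`-linear sheaf morphisms `M|_U ⟶ N|_U`: families of `O(V)`-linear maps `M(V) → N(V)`
for `V ⊆ U` that commute with restriction. -/
@[ext]
structure LocalHom (M N : Modules O) (U : Opens X) where
  app (V : Opens X) (hV : V ≤ U) : M.val.obj (op V) →ₗ[O.obj.obj (op V)] N.val.obj (op V)
  naturality (V W : Opens X) (hV : V ≤ U) (hW : W ≤ V) (m : M.val.obj (op V)) :
    app W (hW.trans hV) (res M hW m) = res N hW (app V hV m)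

namespace LocalHom

variable {M N : Modules O} {U : Opens X}

instance : Zero (LocalHom M N U) where
  zero := ⟨fun _ _ => 0, fun _ _ _ hW _ => (map_zero (res N hW)).symm⟩

instance : Add (LocalHom M N U) where
  add f g := ⟨fun V hV => f.app V hV + g.app V hV, fun V W hV hW m => by
    simp only [LinearMap.add_apply, f.naturality V W hV hW, g.naturality V W hV hW, map_add]⟩

instance : Neg (LocalHom M N U) where
  neg f := ⟨fun V hV => -f.app V hV, fun V W hV hW m => by
    simp only [LinearMap.neg_apply, f.naturality V W hV hW, map_neg]⟩

instance : SMul (O.obj.obj (op U)) (LocalHom M N U) where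
  smul r f := ⟨fun V hV => resO O hV r • f.app V hV, fun V W hV hW m => by
    simp only [LinearMap.smul_apply, f.naturality V W hV hW, res_smul, resO_resO]⟩

instance : AddCommGroup (LocalHom M N U) where
  add_assoc f g h := LocalHom.ext (by funext V hV; exact add_assoc _ _ _)
  zero_add f := LocalHom.ext (by funext V hV; exact zero_add _)
  add_zero f := LocalHom.ext (by funext V hV; exact add_zero _)
  neg_add_cancel f := LocalHom.ext (by funext V hV; exact neg_add_cancel _)
  add_comm f g := LocalHom.ext (by funext V hV; exact add_comm _ _)
  nsmul := nsmulRec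
  zsmul := zsmulRec

lemma add_app (f g : LocalHom M N U) (V : Opens X) (hV : V ≤ U) :
    (f + g).app V hV = f.app V hV + g.app V hV := rfl

lemma smul_app (r : O.obj.obj (op U)) (f : LocalHom M N U) (V : Opens X) (hV : V ≤ U) :
    (r • f).app V hV = resO O hV r • f.app V hV := rfl

instance : Module (O.obj.obj (op U)) (LocalHom M N U) where
  one_smul f := LocalHom.ext (by funext V hV; rw [smul_app, map_one, one_smul])
  mul_smul r s f := LocalHom.ext (by funext V hV; simp only [smul_app, map_mul, mul_smul])
  smul_zero r := LocalHom.ext (by funext V hV; exact smul_zero _)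
  smul_add r f g := LocalHom.ext (by funext V hV; exact smul_add _ _ _)
  add_smul r s f := LocalHom.ext (by funext V hV; simp only [smul_app, add_app, map_add, add_smul])
  zero_smul f := LocalHom.ext (by funext V hV; rw [smul_app, map_zero, zero_smul]; rfl)

/-- Restriction of local morphisms to a smaller open set. -/
def restrict {U' : Opens X} (h : U' ≤ U) : LocalHom M N U →+ LocalHom M N U' where
  toFun f := ⟨fun V hV => f.app V (hV.trans h), fun V W _ hW m => f.naturality V W _ hW m⟩
  map_zero' := rfl
  map_add' _ _ := rfl

end LocalHom

/-- The underlying presheaf of abelian groups of the sheaf of homomorphisms. -/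
def homPresheaf (M N : Modules O) : (Opens X)ᵒᵖ ⥤ AddCommGrpCat.{u} where
  obj U := AddCommGrpCat.of (LocalHom M N U.unop)
  map f := AddCommGrpCat.ofHom (LocalHom.restrict f.unop.le)

instance (M N : Modules O) (U : (Opens X)ᵒᵖ) :
    Module ((ringCatSheaf O).obj.obj U) ((homPresheaf M N).obj U) :=
  inferInstanceAs (Module (O.obj.obj (op U.unop)) (LocalHom M N U.unop))

lemma sec_ext (N : Modules O) {ι : Type u} (U : ι → Opens X) (W : Opens X)
    (hU : ∀ i, U i ≤ W) (hW : W ≤ iSup U) (s t : N.val.obj (op W))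
    (h : ∀ i, res N (hU i) s = res N (hU i) t) : s = t :=
  TopCat.Sheaf.eq_of_locally_eq' (X := TopCat.of X) ⟨N.val.presheaf, N.isSheaf⟩ U W
    (fun i => homOfLE (hU i)) hW s t h

lemma sec_glue (N : Modules O) {ι : Type u} (U : ι → Opens X) (W : Opens X)
    (hU : ∀ i, U i ≤ W) (hW : W ≤ iSup U)
    (s : ∀ i, N.val.obj (op (U i)))
    (h : ∀ i j, res N (inf_le_left : U i ⊓ U j ≤ U i) (s i) =
      res N (inf_le_right : U i ⊓ U j ≤ U j) (s j)) :
    ∃! t : N.val.obj (op W), ∀ i, res N (hU i) t = s i := by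
  let F : TopCat.Sheaf AddCommGrpCat.{u} (TopCat.of X) := ⟨N.val.presheaf, N.isSheaf⟩
  let s' : ∀ i, ToType (F.1.obj (op (U i))) := s
  exact F.existsUnique_gluing' U W (fun i => homOfLE (hU i)) hW s' h

lemma homPresheaf_isSheaf (M N : Modules O) : TopCat.Presheaf.IsSheaf (X := TopCat.of X) (homPresheaf M N) := by
  rw [TopCat.Presheaf.isSheaf_iff_isSheafUniqueGluing]
  intro ι U (sf : ∀ i, LocalHom M N (U i)) hsf
  have compat (i j : ι) (V : Opens X) (hi : V ≤ U i) (hj : V ≤ U j) :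
      (sf i).app V hi = (sf j).app V hj :=
    congrFun (congrFun (congrArg LocalHom.app (hsf i j)) V) (le_inf hi hj)
  have key (V : Opens X) (hV : V ≤ iSup U) (m : M.val.obj (op V)) :
      ∃! t : N.val.obj (op V), ∀ i, res N (inf_le_left : V ⊓ U i ≤ V) t =
        (sf i).app (V ⊓ U i) inf_le_right (res M inf_le_left m) := by
    apply sec_glue N (fun i => V ⊓ U i) V (fun i => inf_le_left)
    · rw [← inf_iSup_eq]; exact le_inf le_rfl hV
    · intro i j
      rw [← LocalHom.naturality, ← LocalHom.naturality, res_res, res_res]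
      rw [compat i j _ _ (inf_le_right.trans inf_le_right)]
  choose g hg hu using key
  have hg' (V : Opens X) (hV : V ≤ iSup U) (m : M.val.obj (op V)) (i : ι) (W : Opens X)
      (h : W ≤ V) (hi : W ≤ U i) : res N h (g V hV m) = (sf i).app W hi (res M h m) := by
    have := congrArg (res N (le_inf h hi)) (hg V hV m i)
    rwa [res_res, ← LocalHom.naturality, res_res] at this
  have hcov (V : Opens X) (hV : V ≤ iSup U) : V ≤ ⨆ i, V ⊓ U i := by
    rw [← inf_iSup_eq]; exact le_inf le_rfl hV
  refine ⟨(⟨fun V hV => ⟨⟨g V hV, ?_⟩, ?_⟩, ?_⟩ : LocalHom M N (iSup U)), ?_, ?_⟩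
  · intro a b
    refine sec_ext N (fun i => V ⊓ U i) V (fun i => inf_le_left) (hcov V hV) _ _ fun i => ?_
    rw [map_add, hg V hV, hg V hV, hg V hV, map_add, map_add]
  · intro r a
    refine sec_ext N (fun i => V ⊓ U i) V (fun i => inf_le_left) (hcov V hV) _ _ fun i => ?_
    change res N _ (g V hV (r • a)) = res N _ (r • g V hV a)
    rw [res_smul, hg V hV, hg V hV, res_smul, map_smul]
  · intro V W hV hW m
    refine sec_ext N (fun i => W ⊓ U i) W (fun i => inf_le_left) (hcov W (hW.trans hV)) _ _ fun i => ?_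
    change res N _ (g W _ (res M hW m)) = res N _ (res N hW (g V hV m))
    rw [hg W, res_res, res_res, hg' V hV m i]
  · intro i
    refine LocalHom.ext ?_
    funext V hV
    refine LinearMap.ext fun m => ?_
    have := hg' V (hV.trans (le_iSup U i)) m i V le_rfl hV
    change g V _ m = (sf i).app V hV m
    have e (N : Modules O) (n : N.val.obj (op V)) : res N le_rfl n = n :=
      ConcreteCategory.congr_hom (N.val.presheaf.map_id (op V)) n
    rwa [e, e] at this
  · intro (f : LocalHom M N (iSup U)) hf
    refine LocalHom.ext ?_
    funext V hV
    refine LinearMap.ext fun m => ?_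
    refine hu V hV m _ fun i => ?_
    rw [← f.naturality]
    have h3 : LocalHom.restrict (le_iSup U i) f = sf i := hf i
    rw [← h3]
    rfl

/-- The sheaf of homomorphisms `U ↦ Hom_{O|_U}(M|_U, N|_U)`. -/
def sheafHom (M N : Modules O) : Modules O where
  val := PresheafOfModules.ofPresheaf (homPresheaf M N) (by
    intro U V f r (m : LocalHom M N U.unop)
    refine LocalHom.ext ?_
    funext W hW
    change resO O (hW.trans f.unop.le) r • m.app W _ = resO O hW (resO O f.unop.le r) • m.app W _
    rw [resO_resO])
  isSheaf := homPresheaf_isSheaf M N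

/-- The dual sheaf `M^∨ = Hom_O(M, O)`. -/
def dual (M : Modules O) : Modules O :=
  sheafHom M (SheafOfModules.unit (ringCatSheaf O))

/-- The tensor product over `O`: the sheaf associated to `U ↦ M(U) ⊗_{O(U)} N(U)`. -/
def tensor (M N : Modules O) : Modules O :=
  (PresheafOfModules.sheafification (𝟙 (ringCatSheaf O).obj)).obj
    (PresheafOfModules.Monoidal.tensorObj M.val N.val)

variable (O) in
/-- The ring `O(X)` of global sections of `O`. -/
abbrev GlobalRing : Type u := O.obj.obj (op ⊤)

variable (O) in
/-- The global sections functor, with values in modules over the ring of global functions. -/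
def globalSections : Modules O ⥤ ModuleCat.{u} (O.obj.obj (op ⊤)) :=
  SheafOfModules.evaluation (ringCatSheaf O) (op ⊤)

instance : (globalSections O).Additive where

/-- `H^q(X, M)`, the `q`-th right derived functor of global sections on `O`-modules. -/
def cohomology (q : ℕ) (M : Modules O) : ModuleCat.{u} (O.obj.obj (op ⊤)) :=
  ((globalSections O).rightDerived q).obj M

/-- The value of a morphism of `O`-modules on the sections over `U`. -/
def appHom {M N : Modules O} (f : M ⟶ N) (U : Opens X) :
    M.val.obj (op U) →ₗ[O.obj.obj (op U)] N.val.obj (op U) :=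
  (f.val.app (op U)).hom

lemma appHom_res {M N : Modules O} (f : M ⟶ N) {U V : Opens X} (h : V ≤ U)
    (m : M.val.obj (op U)) : appHom f V (res M h m) = res N h (appHom f U m) :=
  PresheafOfModules.naturality_apply f.val (homOfLE h).op m

lemma appHom_ext {M N : Modules O} {f g : M ⟶ N} (h : ∀ U m, appHom f U m = appHom g U m) :
    f = g := by
  refine SheafOfModules.hom_ext (PresheafOfModules.hom_ext fun U => ?_)
  ext m
  exact h U.unop m

/-- Restriction of global functions to `U`. -/
def resTop (U : Opens X) : O.obj.obj (op ⊤) →+* O.obj.obj (op U) :=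
  resO O le_top

/-- Multiplication of a morphism of `O`-modules by a global section of `O`. -/
def smulHom {M N : Modules O} (r : O.obj.obj (op ⊤)) (f : M ⟶ N) : M ⟶ N where
  val := PresheafOfModules.homMk
    { app := fun U => AddCommGrpCat.ofHom
        (resTop U.unop r • appHom f U.unop).toAddMonoidHom
      naturality := by
        intro U V i
        ext (m : M.val.obj (op U.unop))
        change resTop V.unop r • appHom f V.unop (res M i.unop.le m) =
          res N i.unop.le (resTop U.unop r • appHom f U.unop m)
        rw [appHom_res, res_smul, resTop, resTop, resO_resO] }
    (fun U a m => (resTop U.unop r • appHom f U.unop).map_smul a m)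

lemma appHom_smulHom {M N : Modules O} (r : O.obj.obj (op ⊤)) (f : M ⟶ N) (U : Opens X) :
    appHom (smulHom r f) U = resTop U r • appHom f U := rfl

/-- The category of `O`-modules is linear over the ring of global sections of `O`. -/
instance linear : Linear (O.obj.obj (op ⊤)) (Modules O) where
  homModule M N :=
   { smul := smulHom
     one_smul f := appHom_ext fun U m => by
      change resTop (O := O) U 1 • appHom f U m = _
      rw [map_one, one_smul]
     mul_smul r s f := appHom_ext fun U m => by
      change resTop U (r * s) • appHom f U m =
        resTop U r • resTop U s • appHom f U m
      rw [map_mul, mul_smul]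
     smul_zero r := appHom_ext fun U m => smul_zero (resTop U r)
     smul_add r f g := appHom_ext fun U m =>
      smul_add (resTop U r) (appHom f U m) (appHom g U m)
     add_smul r s f := appHom_ext fun U m => by
      change resTop U (r + s) • appHom f U m =
        resTop U r • appHom f U m + resTop U s • appHom f U m
      rw [map_add, add_smul]
     zero_smul f := appHom_ext fun U m => by
      change resTop (O := O) U 0 • appHom f U m = (0 : N.val.obj (op U))
      rw [map_zero, zero_smul] }
  smul_comp M N P r f g := appHom_ext fun U m =>
    (appHom g U).map_smul (resTop U r) (appHom f U m)
  comp_smul M N P f r g := rfl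

/-- The sheaf `O_M` of holomorphic functions on a complex manifold `M` modelled on `E`: over the
field `ℂ`, maps of class `C^∞` are the same as holomorphic maps. -/
def holomorphicSheaf (E : Type*) [NormedAddCommGroup E] [NormedSpace ℂ E] (M : Type)
    [TopologicalSpace M] [ChartedSpace E M] :
    Sheaf (Opens.grothendieckTopology M) CommRingCat.{0} :=
  smoothSheafCommRing 𝓘(ℂ, E) 𝓘(ℂ) M ℂ

end

end RingedSpaceModules

open RingedSpaceModules

/-! The argument works on any ringed space. For `F` locally free of finite rank, sending `φ ⊗ n` to
`m ↦ φ m • n` identifies `T = dual F ⊗ -` with the sheaf Hom functor of `F` (`isIso_dualTensorHom`).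
Taking global sections, Hom(F, -) becomes the composite of `T` and global sections. If `T` is exact
and preserves injectives, it carries an injective resolution of `G` to one of `T(G)`, and a single
complex then computes both Ext and cohomology (`nonempty_ext_linearEquiv_rightDerived`).

Both properties of `T` come from the tensor-Hom adjunction (`tensorAdjunction`). As a tensor functor
`T` is a left adjoint; as sheaf Hom it is right adjoint to `F ⊗ -`; so it is exact. Since `F` is
locally flat, `F ⊗ -` preserves monomorphisms, and therefore its right adjoint preserves injectives.

Local freeness is used only through local dual bases (`DualBasis`). The identity `m = ∑ p k m • t k`
exhibits the sections as a retract of a finite free module, which gives flatness, and it gives the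
inverse `Φ ↦ ∑ p k ⊗ Φ (t k)` of the comparison map. Dual bases restrict to smaller open sets, so
these facts hold on all small opens and pass to sheafifications. -/

section HomologicalAlgebra

-- Ext groups from injective resolutions

universe w v t

variable {R : Type t} [CommRing R] {C : Type*} [Category.{v} C] [Abelian C] [Linear R C]

open Abelian

/-- The part in degree `n` of the complex `Hom(X, I)`. -/
noncomputable abbrev InjectiveResolution.homShortComplex (R : Type t) [CommRing R] [Linear R C]
    (X : C) {Y : C} (I : InjectiveResolution Y) (n : ℕ) : ShortComplex (ModuleCat.{v} R) :=
  ((((linearCoyoneda R C).obj (op X)).mapHomologicalComplex (.up ℕ)).obj I.cocomplex).sc'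
    ((ComplexShape.up ℕ).prev n) n (n + 1)

/-- The class in `Ext` of a cocycle with values in an injective resolution, as a linear map. -/
noncomputable def InjectiveResolution.extMkLinearMap [HasExt.{w} C] (R : Type t) [CommRing R]
    [Linear R C] {X Y : C} (I : InjectiveResolution Y) (n : ℕ) :
    LinearMap.ker (InjectiveResolution.homShortComplex R X I n).g.hom →ₗ[R] Ext X Y n where
  toFun f := I.extMk f.1 (n + 1) rfl f.2
  map_add' f g := (I.add_extMk _ _ _ _ _ _).symm
  map_smul' r f := by
    -- A scalar acts on Ext and on cocycles alike as precomposition with `r • 𝟙 X`.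
    have h := I.mk₀_comp_extMk f.1 (n + 1) rfl f.2 (r • 𝟙 X)
    rw [Ext.mk₀_smul, Ext.smul_comp, Ext.mk₀_id_comp] at h
    refine Eq.trans ?_ h.symm
    congr 1
    have (g : X ⟶ I.cocomplex.X n) : r • g = (r • 𝟙 X) ≫ g := by simp
    exact this f.1

/-- In degree 0 the only coboundary is zero, because the resolution, extended to integer degrees,
vanishes in degree -1. -/
lemma InjectiveResolution.extMk_zero_eq_zero_iff [HasExt.{w} C] {X Y : C}
    (I : InjectiveResolution Y) (f : X ⟶ I.cocomplex.X 0) (hf : f ≫ I.cocomplex.d 0 1 = 0) :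
    I.extMk f 1 rfl hf = 0 ↔ f = 0 := by
  constructor
  · intro h
    simp only [← I.extEquivCohomologyClass.apply_eq_iff_eq,
      CategoryTheory.InjectiveResolution.extEquivCohomologyClass_extMk,
      CategoryTheory.InjectiveResolution.extEquivCohomologyClass_zero,
      CochainComplex.HomComplex.CohomologyClass.mk_eq_zero_iff] at h
    rw [CochainComplex.HomComplex.Cocycle.fromSingleMk_mem_coboundaries_iff _ _ _ _ _ (-1)
      (by simp)] at h
    obtain ⟨g, hg⟩ := h
    have hg0 : g = 0 := (CochainComplex.isZero_of_isStrictlyGE I.cochainComplex 0 (-1)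
      (by lia)).eq_of_tgt _ _
    rw [hg0, zero_comp] at hg
    rw [← cancel_mono (I.cochainComplexXIso (0 : ℕ) 0 rfl).inv, zero_comp]
    exact hg.symm
  · rintro rfl
    exact I.extMk_zero _ _

/-- Using `prev n` treats degree 0 together with positive degrees, in the form required by the
homology of a complex indexed by `ℕ`. -/
lemma InjectiveResolution.extMk_eq_zero_iff_prev [HasExt.{w} C] {X Y : C}
    (I : InjectiveResolution Y) {n : ℕ} (f : X ⟶ I.cocomplex.X n)
    (hf : f ≫ I.cocomplex.d n (n + 1) = 0) :
    I.extMk f (n + 1) rfl hf = 0 ↔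
      ∃ g : X ⟶ I.cocomplex.X ((ComplexShape.up ℕ).prev n), g ≫ I.cocomplex.d _ n = f := by
  cases n with
  | zero =>
    rw [InjectiveResolution.extMk_zero_eq_zero_iff I f hf]
    -- Here `prev 0` takes its default value 0, and the differential from degree 0 to itself is
    -- zero, so the right side says `f = 0`.
    simp [eq_comm]
  | succ n =>
    rw [I.extMk_eq_zero_iff f (n + 2) rfl hf n rfl, CochainComplex.prev_nat_succ]

lemma InjectiveResolution.extMkLinearMap_surjective [HasExt.{w} C] {X Y : C}
    (I : InjectiveResolution Y) (n : ℕ) :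
    Function.Surjective (InjectiveResolution.extMkLinearMap R (X := X) I n) := fun α => by
  obtain ⟨f, hf, h⟩ := I.extMk_surjective α (n + 1) rfl
  exact ⟨⟨f, hf⟩, h⟩

lemma InjectiveResolution.range_toCycles_eq_ker_extMkLinearMap [HasExt.{w} C] {X Y : C}
    (I : InjectiveResolution Y) (n : ℕ) :
    LinearMap.range (InjectiveResolution.homShortComplex R X I n).moduleCatToCycles =
      LinearMap.ker (InjectiveResolution.extMkLinearMap R (X := X) I n) := by
  ext ⟨f, hf⟩
  refine Iff.trans ?_ (InjectiveResolution.extMk_eq_zero_iff_prev (X := X) I f hf).symm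
  exact ⟨fun ⟨g, hg⟩ => ⟨g, congrArg Subtype.val hg⟩, fun ⟨g, hg⟩ => ⟨g, Subtype.ext hg⟩⟩

/-- `Ext` is computed by an injective resolution, linearly over the base ring. -/
noncomputable def InjectiveResolution.extLinearEquivHomology [HasExt.{w} C]
    {X Y : C} (I : InjectiveResolution Y) (n : ℕ) :
    Ext X Y n ≃ₗ[R]
      ((((linearCoyoneda R C).obj (op X)).mapHomologicalComplex _).obj I.cocomplex).homology n :=
  ((InjectiveResolution.extMkLinearMap R I n).quotKerEquivOfSurjective
      (InjectiveResolution.extMkLinearMap_surjective I n)).symm ≪≫ₗ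
    (Submodule.quotEquivOfEq _ _
      (InjectiveResolution.range_toCycles_eq_ker_extMkLinearMap I n)).symm ≪≫ₗ
    (InjectiveResolution.homShortComplex R X I n).moduleCatHomologyIso.symm.toLinearEquiv ≪≫ₗ
    (ShortComplex.homologyMapIso
      (HomologicalComplex.isoSc' _ _ n (n + 1) rfl (by simp))).symm.toLinearEquiv

variable {D : Type*} [Category* D] [Abelian D]

/-- The image of an injective resolution under an exact functor preserving injective objects. -/
noncomputable def InjectiveResolution.mapOfPreservesInjectiveObjects {Y : C}
    (I : InjectiveResolution Y) (T : C ⥤ D) [T.Additive] [PreservesFiniteLimits T]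
    [PreservesFiniteColimits T] [T.PreservesInjectiveObjects] :
    InjectiveResolution (T.obj Y) where
  cocomplex := (T.mapHomologicalComplex _).obj I.cocomplex
  injective n := T.injective_obj (I.cocomplex.X n)
  -- Exactness of `T` keeps the augmentation a quasi-isomorphism; the first factor only moves `T`
  -- inside the complex concentrated in degree 0.
  ι := (HomologicalComplex.singleMapHomologicalComplex T _ 0).inv.app Y ≫
    (T.mapHomologicalComplex _).map I.ι

/-- If `Hom(X, -)` is the composition of an exact functor `T` preserving injective objects and of
`Γ`, then the right derived functors of `Γ` compute the `Ext` groups. -/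
theorem nonempty_ext_linearEquiv_rightDerived [HasExt.{w} C] [HasInjectiveResolutions C]
    [HasInjectiveResolutions D] (T : C ⥤ D) [T.Additive] [PreservesFiniteLimits T]
    [PreservesFiniteColimits T] [T.PreservesInjectiveObjects] (Γ : D ⥤ ModuleCat.{v} R)
    [Γ.Additive] {X : C} (e : (linearCoyoneda R C).obj (op X) ≅ T ⋙ Γ) (Y : C) (n : ℕ) :
    Nonempty (Ext X Y n ≃ₗ[R] (Γ.rightDerived n).obj (T.obj Y)) := by
  obtain ⟨I⟩ := HasInjectiveResolutions.out Y
  let J := InjectiveResolution.mapOfPreservesInjectiveObjects I.some T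
  exact ⟨InjectiveResolution.extLinearEquivHomology I.some n ≪≫ₗ
    ((HomologicalComplex.homologyFunctor _ _ n).mapIso
      ((NatIso.mapHomologicalComplex e _).app I.some.cocomplex)).toLinearEquiv ≪≫ₗ
    (J.isoRightDerivedObj Γ n).symm.toLinearEquiv⟩

end HomologicalAlgebra

/-! ### Local dual bases of locally free sheaves -/

namespace RingedSpaceModules

noncomputable section

variable {X : Type u} [TopologicalSpace X]
  {O : Sheaf (Opens.grothendieckTopology X) CommRingCat.{u}}

/-- Restricting a section does not change it if the open set stays the same. -/
lemma res_refl (M : Modules O) {U : Opens X} (m : M.val.obj (op U)) : res M le_rfl m = m :=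
  ConcreteCategory.congr_hom (M.val.presheaf.map_id (op U)) m

/-- A finite dual basis of `M` over the open set `U`: sections `t k` of `M` and linear forms
`p k` on `M|_U` such that `m = ∑ k, p k m • t k` for all sections `m` over subsets of `U`. -/
structure DualBasis (M : Modules O) (U : Opens X) where
  /-- the index type -/
  ι : Type u
  [fintype : Fintype ι]
  /-- the sections -/
  t : ι → M.val.obj (op U)
  /-- the linear forms -/
  p : ι → LocalHom M (SheafOfModules.unit (ringCatSheaf O)) U
  sum_smul (V : Opens X) (hV : V ≤ U) (m : M.val.obj (op V)) :
    m = ∑ k, (show O.obj.obj (op V) from (p k).app V hV m) • res M hV (t k)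

attribute [instance] DualBasis.fintype

section

open scoped Classical in
/-- The projections of a finite free sheaf of modules. -/
def freeProj {C : Type*} [Category* C] {J : GrothendieckTopology C} (R : Sheaf J RingCat.{u})
    [HasWeakSheafify J AddCommGrpCat.{u}] [J.WEqualsLocallyBijective AddCommGrpCat.{u}]
    {I : Type u} (k : I) :
    SheafOfModules.free (R := R) I ⟶ SheafOfModules.unit R :=
  Cofan.IsColimit.desc (SheafOfModules.isColimitFreeCofan I) fun l => if l = k then 𝟙 _ else 0

open scoped Classical in
lemma ιFree_freeProj {C : Type*} [Category* C] {J : GrothendieckTopology C}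
    (R : Sheaf J RingCat.{u})
    [HasWeakSheafify J AddCommGrpCat.{u}] [J.WEqualsLocallyBijective AddCommGrpCat.{u}]
    {I : Type u} (l k : I) :
    SheafOfModules.ιFree l ≫ freeProj R k = if l = k then 𝟙 _ else 0 :=
  Cofan.IsColimit.fac (SheafOfModules.isColimitFreeCofan I) _ _

lemma sum_freeProj_ιFree {C : Type*} [Category* C] {J : GrothendieckTopology C}
    (R : Sheaf J RingCat.{u})
    [HasWeakSheafify J AddCommGrpCat.{u}] [J.WEqualsLocallyBijective AddCommGrpCat.{u}]
    {I : Type u} [Fintype I] :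
    ∑ k : I, freeProj R k ≫ SheafOfModules.ιFree k = 𝟙 _ := by
  classical
  refine Cofan.IsColimit.hom_ext (SheafOfModules.isColimitFreeCofan I) _ _ fun l => ?_
  change SheafOfModules.ιFree l ≫ _ = SheafOfModules.ιFree l ≫ 𝟙 _
  rw [Preadditive.comp_sum, Finset.sum_eq_single l, ← Category.assoc, ιFree_freeProj, if_pos rfl,
    Category.id_comp, Category.comp_id]
  · intro k _ h
    rw [← Category.assoc, ιFree_freeProj, if_neg h.symm, zero_comp]
  · simp

end

/-- A linear form on the restriction of `M` to `U`, as a local homomorphism. -/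
def LocalHom.ofOver {M N : Modules O} {U : Opens X} (f : M.over U ⟶ N.over U) :
    LocalHom M N U where
  app V hV := (f.val.app (op (Over.mk (homOfLE hV)))).hom
  naturality V W hV hW m := PresheafOfModules.naturality_apply f.val
    (Over.homMk (U := Over.mk (homOfLE (hW.trans hV))) (V := Over.mk (homOfLE hV))
      (homOfLE hW)).op m

/-- The structure sheaf is generated by its section 1, which restricts to 1, and `c = c * 1`. -/
lemma LocalHom.app_unit {M : Modules O} {U : Opens X}
    (a : LocalHom (SheafOfModules.unit (ringCatSheaf O)) M U) (V : Opens X) (hV : V ≤ U)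
    (c : O.obj.obj (op V)) :
    a.app V hV c = c • res M hV (a.app U le_rfl (1 : O.obj.obj (op U))) := by
  have h : res (SheafOfModules.unit (ringCatSheaf O)) hV (1 : O.obj.obj (op U)) =
      (1 : O.obj.obj (op V)) := map_one (resO O hV)
  have h1 := a.naturality U V le_rfl hV (1 : O.obj.obj (op U))
  rw [h] at h1
  rw [← h1]
  exact (congrArg (a.app V hV) (mul_one c).symm).trans
    ((a.app V hV).map_smul c (1 : O.obj.obj (op V)))

/-- Evaluation of a morphism of sheaves of modules at a section, as an additive map. -/
def evalHom {C : Type*} [Category* C] {J : GrothendieckTopology C} {R : Sheaf J RingCat.{u}}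
    {M N : SheafOfModules.{u} R} (V : Cᵒᵖ) (m : M.val.obj V) : (M ⟶ N) →+ N.val.obj V where
  toFun f := f.val.app V m
  map_zero' := rfl
  map_add' _ _ := rfl

/-- An isomorphism from a finite free module to the restriction of `M` to `U` gives a dual basis. -/
def DualBasis.ofIso {M : Modules O} {U : Opens X} {I : Type u} [Fintype I]
    (e : SheafOfModules.free I ≅ M.over U) : DualBasis M U where
  ι := I
  t k := (SheafOfModules.ιFree k ≫ e.hom).val.app (op (Over.mk (𝟙 U)))
    (1 : O.obj.obj (op U))
  p k := LocalHom.ofOver (N := SheafOfModules.unit (ringCatSheaf O)) (e.inv ≫ freeProj _ k)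
  sum_smul V hV m := by
    -- The decomposition of the identity of the free module, conjugated by `e`; evaluated at `m` it
    -- is the dual basis identity.
    have h : ∑ k, (e.inv ≫ freeProj _ k) ≫ (SheafOfModules.ιFree k ≫ e.hom) = 𝟙 _ := by
      have := congrArg (fun f => e.inv ≫ f ≫ e.hom) (sum_freeProj_ιFree _ (I := I))
      simpa [Preadditive.sum_comp, Preadditive.comp_sum] using this
    have h2 := congrArg (evalHom (M := M.over U) (op (Over.mk (homOfLE hV))) m) h
    rw [map_sum] at h2
    exact h2.symm.trans (Finset.sum_congr rfl fun k _ =>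
      (LocalHom.ofOver (M := SheafOfModules.unit (ringCatSheaf O))
        (SheafOfModules.ιFree k ≫ e.hom)).app_unit V hV _)

theorem IsLocallyFreeOfFiniteRank.exists_dualBasis {M : Modules O}
    (hM : IsLocallyFreeOfFiniteRank M) (x : X) :
    ∃ U : Opens X, x ∈ U ∧ Nonempty (DualBasis M U) := by
  obtain ⟨q, hq, hq'⟩ := hM
  obtain ⟨U, f, hU, hx⟩ := q.coversTop ⊤ x trivial
  obtain ⟨i, ⟨g⟩⟩ := hU
  -- The open set is the whole member `q.X i` of the cover, since the trivialisation is given there.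
  refine ⟨q.X i, g.le hx, ?_⟩
  have := hq.isIso i
  have := (hq'.isFiniteType i).finite
  have := Fintype.ofFinite (q.generators i).I
  exact ⟨DualBasis.ofIso (asIso (q.generators i).π)⟩

/-! ### The tensor-Hom adjunction -/

open TensorProduct

/-- The presheaf tensor product of two sheaves of modules. -/
abbrev preTensor (M N : Modules O) : PresheafOfModules.{u} (ringCatSheaf O).obj :=
  PresheafOfModules.Monoidal.tensorObj M.val N.val

/-- The presheaf of modules underlying a sheaf of modules. -/
abbrev underlying (P : Modules O) : PresheafOfModules.{u} (ringCatSheaf O).obj :=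
  (PresheafOfModules.restrictScalars (𝟙 (ringCatSheaf O).obj)).obj P.val

variable {M N P : Modules O}

/-- Restriction of sections of the presheaf tensor product. -/
def preTensorRes (M N : Modules O) {U V : Opens X} (h : V ≤ U) :
    (M.val.obj (op U) ⊗[O.obj.obj (op U)] N.val.obj (op U)) →+
      (M.val.obj (op V) ⊗[O.obj.obj (op V)] N.val.obj (op V)) :=
  ((preTensor M N).presheaf.map (homOfLE h).op).hom

lemma preTensorRes_tmul {U V : Opens X} (h : V ≤ U) (m : M.val.obj (op U))
    (n : N.val.obj (op U)) :
    preTensorRes M N h (m ⊗ₜ n) = res M h m ⊗ₜ res N h n :=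
  rfl

/-- Morphisms from the presheaf tensor product are compatible families of bilinear maps. -/
def preTensorLift
    (b : ∀ U : Opens X, M.val.obj (op U) →ₗ[O.obj.obj (op U)] N.val.obj (op U)
      →ₗ[O.obj.obj (op U)] P.val.obj (op U))
    (hb : ∀ (U V : Opens X) (h : V ≤ U) (m : M.val.obj (op U)) (n : N.val.obj (op U)),
      b V (res M h m) (res N h n) = res P h (b U m n)) :
    preTensor M N ⟶ underlying P :=
  PresheafOfModules.homMk
    { app := fun U => AddCommGrpCat.ofHom (TensorProduct.lift (b U.unop)).toAddMonoidHom
      naturality := fun U V i => by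
        ext (x : M.val.obj (op U.unop) ⊗[O.obj.obj (op U.unop)] N.val.obj (op U.unop))
        change TensorProduct.lift (b V.unop) (preTensorRes M N i.unop.le x) =
          res P i.unop.le (TensorProduct.lift (b U.unop) x)
        induction x using TensorProduct.induction_on with
        | zero => simp only [map_zero]
        | tmul m n =>
          rw [preTensorRes_tmul, TensorProduct.lift.tmul, TensorProduct.lift.tmul, hb]
        | add x y hx hy => simp only [map_add, hx, hy] }
    (fun U a m => (TensorProduct.lift (b U.unop)).map_smul a m)

/-- The value of a morphism from the presheaf tensor product on sections over `U`. -/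
def preApp (f : preTensor M N ⟶ underlying P) (U : Opens X) :
    (M.val.obj (op U) ⊗[O.obj.obj (op U)] N.val.obj (op U)) →ₗ[O.obj.obj (op U)]
      P.val.obj (op U) where
  toFun x := f.app (op U) x
  map_add' x y := map_add (f.app (op U)).hom x y
  map_smul' r x := (f.app (op U)).hom.map_smul r x

lemma preApp_preTensorLift
    (b : ∀ U : Opens X, M.val.obj (op U) →ₗ[O.obj.obj (op U)] N.val.obj (op U)
      →ₗ[O.obj.obj (op U)] P.val.obj (op U)) (hb) (U : Opens X) :
    preApp (preTensorLift b hb) U = TensorProduct.lift (b U) := rfl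

lemma preApp_res (f : preTensor M N ⟶ underlying P) {U V : Opens X} (h : V ≤ U)
    (x : M.val.obj (op U) ⊗[O.obj.obj (op U)] N.val.obj (op U)) :
    preApp f V (preTensorRes M N h x) = res P h (preApp f U x) :=
  PresheafOfModules.naturality_apply f (homOfLE h).op x

lemma preApp_ext {f g : preTensor M N ⟶ underlying P}
    (h : ∀ U m n, preApp f U (m ⊗ₜ n) = preApp g U (m ⊗ₜ n)) : f = g := by
  refine PresheafOfModules.hom_ext fun U => ?_
  ext (x : M.val.obj (op U.unop) ⊗[O.obj.obj (op U.unop)] N.val.obj (op U.unop))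
  have : preApp f U.unop = preApp g U.unop := TensorProduct.ext' (h U.unop)
  exact LinearMap.congr_fun this x

/-- The functor `M ⊗ -`. -/
def tensorFunctor (M : Modules O) : Modules O ⥤ Modules O :=
  SheafOfModules.forget _ ⋙ MonoidalCategory.tensorLeft
    (C := PresheafOfModules.{u} (O.obj ⋙ forget₂ CommRingCat RingCat)) M.val ⋙
    PresheafOfModules.sheafification (𝟙 (ringCatSheaf O).obj)

/-- The functor `Hom(M, -)` with values in sheaves of modules. -/
def sheafHomFunctor (M : Modules O) : Modules O ⥤ Modules O where
  obj := sheafHom M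
  map {N P} f :=
    { val := PresheafOfModules.homMk
        { app := fun U => AddCommGrpCat.ofHom (AddMonoidHom.mk'
            (fun (φ : LocalHom M N U.unop) => (⟨fun V hV => appHom f V ∘ₗ φ.app V hV,
              fun V W hV hW m => by
                simp only [LinearMap.comp_apply, φ.naturality V W hV hW, appHom_res]⟩ :
              LocalHom M P U.unop))
            fun φ ψ => LocalHom.ext (by
              funext V hV
              exact LinearMap.comp_add _ _ _))
          naturality := fun U V i => rfl }
        (fun U a (φ : LocalHom M N U.unop) => LocalHom.ext (by
          funext V hV
          exact LinearMap.comp_smul _ _ _)) }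
  map_id N := rfl
  map_comp f g := rfl

/-- Morphisms from the presheaf tensor product `M ⊗ N` to a sheaf `P` correspond to morphisms
from `N` to the sheaf of homomorphisms. -/
def preTensorHomEquiv (M N P : Modules O) :
    (preTensor M N ⟶ underlying P) ≃ (N ⟶ sheafHom M P) where
  toFun f :=
    { val := PresheafOfModules.homMk
        { app := fun U => AddCommGrpCat.ofHom (AddMonoidHom.mk'
            (fun (n : N.val.obj (op U.unop)) => (⟨fun V hV =>
              preApp f V ∘ₗ (TensorProduct.mk (O.obj.obj (op V)) _ _).flip (res N hV n),
              fun V W hV hW m => by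
                change preApp f W (res M hW m ⊗ₜ res N _ n) =
                  res P hW (preApp f V (m ⊗ₜ res N hV n))
                rw [← preApp_res, preTensorRes_tmul, res_res]⟩ : LocalHom M P U.unop))
            fun n n' => LocalHom.ext (by
              funext V hV
              refine LinearMap.ext fun m => ?_
              change preApp f V (m ⊗ₜ res N hV (n + n')) =
                preApp f V (m ⊗ₜ res N hV n) + preApp f V (m ⊗ₜ res N hV n')
              rw [map_add, TensorProduct.tmul_add, map_add]))
          naturality := fun U V i => by
            ext (n : N.val.obj (op U.unop))
            refine LocalHom.ext ?_
            funext W hW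
            refine LinearMap.ext fun m => ?_
            change preApp f W (m ⊗ₜ res N hW (res N i.unop.le n)) =
              preApp f W (m ⊗ₜ res N _ n)
            rw [res_res] }
        (fun U a (n : N.val.obj (op U.unop)) => LocalHom.ext (by
          funext V hV
          refine LinearMap.ext fun m => ?_
          change preApp f V (m ⊗ₜ res N hV ((show O.obj.obj (op U.unop) from a) • n)) =
            resO O hV a • preApp f V (m ⊗ₜ res N hV n)
          rw [res_smul, TensorProduct.tmul_smul, map_smul])) }
  -- Uncurrying only needs the component of `g n` over `U` itself; compatibility of `g` with
  -- restriction recovers the components over smaller opens.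
  invFun g := preTensorLift (fun U => LinearMap.mk₂ (O.obj.obj (op U))
      (fun m n => (show LocalHom M P U from appHom g U n).app U le_rfl m)
      (fun m m' n => map_add _ _ _)
      (fun r m n => map_smul _ _ _)
      (fun m n n' => by rw [map_add]; rfl)
      (fun r m n => by
        rw [map_smul]
        exact congrArg (· • (show LocalHom M P U from appHom g U n).app U le_rfl m)
          (resO_refl r)))
    (fun U V h m n => by
      change (show LocalHom M P V from appHom g V (res N h n)).app V le_rfl (res M h m) = _
      rw [appHom_res]
      exact (show LocalHom M P U from appHom g U n).naturality U V le_rfl h m)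
  left_inv f := preApp_ext fun U m n => by
    rw [preApp_preTensorLift]
    change preApp f U (m ⊗ₜ res N le_rfl n) = _
    rw [res_refl]
  right_inv g := appHom_ext fun U n => by
    refine LocalHom.ext ?_
    funext V hV
    refine LinearMap.ext fun m => ?_
    change (show LocalHom M P V from appHom g V (res N hV n)).app V le_rfl m =
      (show LocalHom M P U from appHom g U n).app V hV m
    rw [appHom_res]
    rfl

variable (O) in
/-- The sheafification adjunction for presheaves of `O`-modules. -/
abbrev sheafifyAdj := PresheafOfModules.sheafificationAdjunction (𝟙 (ringCatSheaf O).obj)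

/-- The functor `M ⊗ -` is left adjoint to `Hom(M, -)`. -/
def tensorAdjunction (M : Modules O) : tensorFunctor M ⊣ sheafHomFunctor M :=
  Adjunction.mkOfHomEquiv
    { homEquiv := fun N P =>
        ((sheafifyAdj O).homEquiv (preTensor M N) P).trans (preTensorHomEquiv M N P)
      homEquiv_naturality_left_symm := fun {N' N P} f g => by
        have h : (preTensorHomEquiv M N' P).symm (f ≫ g) = MonoidalCategory.whiskerLeft
            (C := PresheafOfModules.{u} (O.obj ⋙ forget₂ CommRingCat RingCat)) M.val f.val ≫
            (preTensorHomEquiv M N P).symm g := preApp_ext fun U m n => rfl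
        exact (congrArg ((sheafifyAdj O).homEquiv (preTensor M N') P).symm h).trans
          ((sheafifyAdj O).homEquiv_naturality_left_symm _ _)
      homEquiv_naturality_right := fun {N P P'} f g =>
        congrArg (preTensorHomEquiv M N P')
          ((sheafifyAdj O).homEquiv_naturality_right (X := preTensor M N) f g) }

/-! ### Locally bijective morphisms and sheafification -/

section Local

variable {R : (Opens X)ᵒᵖ ⥤ RingCat.{u}} {P Q : PresheafOfModules.{u} R} (f : P ⟶ Q)

/-- Sections over `W` with equal images already agree on `W ⊓ U`; this is why injectivity is asked
on every open subset of `U`. -/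
lemma isLocallyInjective_of_locally_injective
    (h : ∀ x : X, ∃ U : Opens X, x ∈ U ∧ ∀ V ≤ U, Function.Injective (f.app (op V))) :
    PresheafOfModules.IsLocallyInjective (Opens.grothendieckTopology X) f where
  equalizerSieve_mem {W} a b hab x hx := by
    obtain ⟨U, hxU, hU⟩ := h x
    refine ⟨W.unop ⊓ U, homOfLE inf_le_left, ?_, hx, hxU⟩
    refine hU _ inf_le_right ?_
    have h1 (c : P.obj W) := PresheafOfModules.naturality_apply f
      (homOfLE (inf_le_left : W.unop ⊓ U ≤ W.unop)).op c
    exact (h1 a).trans ((congrArg (Q.map _) hab).trans (h1 b).symm)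

lemma isLocallySurjective_of_locally_surjective
    (h : ∀ x : X, ∃ U : Opens X, x ∈ U ∧ ∀ V ≤ U, Function.Surjective (f.app (op V))) :
    PresheafOfModules.IsLocallySurjective (Opens.grothendieckTopology X) f where
  imageSieve_mem {W} a x hx := by
    obtain ⟨U, hxU, hU⟩ := h x
    refine ⟨W ⊓ U, homOfLE inf_le_left, ?_, hx, hxU⟩
    exact hU _ inf_le_right (Q.map (homOfLE (inf_le_left : W ⊓ U ≤ W)).op a)

end Local

section Sheafification

variable {P Q : PresheafOfModules.{u} (ringCatSheaf O).obj} (f : P ⟶ Q)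

/-- The underlying abelian sheaf of the sheafified module is the usual sheafification, where local
injectivity gives a monomorphism; the faithful functor `toSheaf` reflects it. -/
lemma mono_sheafification_map
    [PresheafOfModules.IsLocallyInjective (Opens.grothendieckTopology X) f] :
    Mono ((PresheafOfModules.sheafification (𝟙 (ringCatSheaf O).obj)).map f) := by
  have h := (Presheaf.isLocallyInjective_presheafToSheaf_map_iff (Opens.grothendieckTopology X)
    ((PresheafOfModules.toPresheaf _).map f)).2 inferInstance
  have h2 := Sheaf.mono_of_isLocallyInjective
    ((presheafToSheaf (Opens.grothendieckTopology X) AddCommGrpCat.{u}).map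
      ((PresheafOfModules.toPresheaf _).map f))
  exact (SheafOfModules.toSheaf _).mono_of_mono_map h2

/-- The adjunct is the sheafification of `g` followed by the counit. Sheafification inverts locally
bijective maps, and the counit at a sheaf is an isomorphism. -/
lemma isIso_sheafificationAdjunction_homEquiv_symm {C : Type u} [SmallCategory C]
    {J : GrothendieckTopology C} {P : Cᵒᵖ ⥤ AddCommGrpCat.{u}} {F : Sheaf J AddCommGrpCat.{u}}
    (g : P ⟶ F.obj) (_ : Presheaf.IsLocallyInjective J g)
    (_ : Presheaf.IsLocallySurjective J g) :
    IsIso (((sheafificationAdjunction J AddCommGrpCat.{u}).homEquiv P F).symm g) := by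
  rw [Adjunction.homEquiv_counit]
  have := (J.W_iff _).1 (J.W_of_isLocallyBijective g)
  infer_instance

lemma isIso_sheafifyAdj_homEquiv_symm {N : Modules O} (g : P ⟶ underlying N)
    (hi : PresheafOfModules.IsLocallyInjective (Opens.grothendieckTopology X) g)
    (hs : PresheafOfModules.IsLocallySurjective (Opens.grothendieckTopology X) g) :
    IsIso (((sheafifyAdj O).homEquiv P N).symm g) := by
  -- This form of the bijection has a known image under `toSheaf`, which reduces the claim to
  -- abelian sheaves.
  have h : (sheafifyAdj O).homEquiv P N =
      PresheafOfModules.sheafificationHomEquiv (𝟙 (ringCatSheaf O).obj) :=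
    Equiv.ext fun f => PresheafOfModules.sheafificationAdjunction_homEquiv_apply _ f
  have : IsIso ((SheafOfModules.toSheaf _).map (((sheafifyAdj O).homEquiv P N).symm g)) := by
    rw [h]
    exact (congrArg IsIso (PresheafOfModules.toSheaf_map_sheafificationHomEquiv_symm
      (𝟙 (ringCatSheaf O).obj) g)).mpr (isIso_sheafificationAdjunction_homEquiv_symm
        (F := (SheafOfModules.toSheaf _).obj N) ((PresheafOfModules.toPresheaf _).map g) hi hs)
  exact isIso_of_reflects_iso _ (SheafOfModules.toSheaf _)

end Sheafification

/-! ### Flatness -/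

/-- Restriction of a dual basis to a smaller open set. -/
def DualBasis.restrict {U V : Opens X} (D : DualBasis M U) (h : V ≤ U) : DualBasis M V where
  ι := D.ι
  t k := res M h (D.t k)
  p k := LocalHom.restrict h (D.p k)
  sum_smul W hW m := by
    simp only [res_res]
    exact D.sum_smul W (hW.trans h) m

/-- The coordinates `p k` followed by the linear combination of the `t k` are the identity, so the
module is a retract of a finite free one. -/
lemma DualBasis.flat {U : Opens X} (D : DualBasis M U) :
    Module.Flat (O.obj.obj (op U)) (M.val.obj (op U)) := by
  let i : M.val.obj (op U) →ₗ[O.obj.obj (op U)] (D.ι → O.obj.obj (op U)) :=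
    LinearMap.pi fun k => (D.p k).app U le_rfl
  let r : (D.ι → O.obj.obj (op U)) →ₗ[O.obj.obj (op U)] M.val.obj (op U) :=
    Fintype.linearCombination _ D.t
  refine Module.Flat.of_retract i r (LinearMap.ext fun m => ?_)
  refine (Fintype.linearCombination_apply _ _ _).trans ((D.sum_smul U le_rfl m).trans ?_).symm
  refine Finset.sum_congr rfl fun k _ => ?_
  rw [res_refl]
  rfl

/-- Tensoring with a module with local dual bases preserves monomorphisms. -/
lemma preservesMonomorphisms_tensorFunctor
    (hM : ∀ x : X, ∃ U : Opens X, x ∈ U ∧ Nonempty (DualBasis M U)) :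
    (tensorFunctor M).PreservesMonomorphisms where
  preserves {N N'} f hf := by
    -- Passing to presheaves is a right adjoint, so a monomorphism of sheaves is injective on
    -- sections over every open set.
    have := Functor.preservesMonomorphisms_of_adjunction (sheafifyAdj O)
    have hf' := (SheafOfModules.forget (ringCatSheaf O) ⋙
      PresheafOfModules.restrictScalars (𝟙 (ringCatSheaf O).obj)).map_mono f
    have := isLocallyInjective_of_locally_injective (MonoidalCategory.whiskerLeft
        (C := PresheafOfModules.{u} (O.obj ⋙ forget₂ CommRingCat RingCat)) M.val f.val)
        fun x => by
      obtain ⟨U, hx, ⟨D⟩⟩ := hM x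
      refine ⟨U, hx, fun V hV => ?_⟩
      have := (D.restrict hV).flat
      exact Module.Flat.lTensor_preserves_injective_linearMap (appHom f V)
        (PresheafOfModules.injective_of_mono ((SheafOfModules.forget (ringCatSheaf O) ⋙
          PresheafOfModules.restrictScalars (𝟙 (ringCatSheaf O).obj)).map f) (op V) :
          Function.Injective (appHom f V))
    exact mono_sheafification_map (MonoidalCategory.whiskerLeft
        (C := PresheafOfModules.{u} (O.obj ⋙ forget₂ CommRingCat RingCat)) M.val f.val)

/-! ### The comparison of `dual M ⊗ N` with the sheaf of homomorphisms -/

/-- The local homomorphism `m ↦ φ m • n`. -/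
def LocalHom.smulSection {U : Opens X} (φ : LocalHom M (SheafOfModules.unit (ringCatSheaf O)) U)
    (n : N.val.obj (op U)) : LocalHom M N U where
  app V hV := LinearMap.toSpanSingleton (O.obj.obj (op V)) (N.val.obj (op V)) (res N hV n) ∘ₗ
    (φ.app V hV)
  naturality V W hV hW m := by
    change (show O.obj.obj (op W) from φ.app W _ (res M hW m)) • res N _ n =
      res N hW ((show O.obj.obj (op V) from φ.app V hV m) • res N hV n)
    rw [res_smul, res_res, φ.naturality]
    rfl

lemma LocalHom.smulSection_app {U : Opens X}
    (φ : LocalHom M (SheafOfModules.unit (ringCatSheaf O)) U) (n : N.val.obj (op U))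
    (V : Opens X) (hV : V ≤ U) (m : M.val.obj (op V)) :
    (φ.smulSection n).app V hV m = (show O.obj.obj (op V) from φ.app V hV m) • res N hV n := rfl

lemma LocalHom.add_smulSection {U : Opens X}
    (φ ψ : LocalHom M (SheafOfModules.unit (ringCatSheaf O)) U) (n : N.val.obj (op U)) :
    (φ + ψ).smulSection n = φ.smulSection n + ψ.smulSection n := LocalHom.ext (by
  funext V hV
  exact LinearMap.ext fun m => add_smul _ _ _)

lemma LocalHom.smul_smulSection {U : Opens X} (r : O.obj.obj (op U))
    (φ : LocalHom M (SheafOfModules.unit (ringCatSheaf O)) U) (n : N.val.obj (op U)) :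
    (r • φ).smulSection n = r • φ.smulSection n := LocalHom.ext (by
  funext V hV
  exact LinearMap.ext fun m => mul_smul _ _ _)

lemma LocalHom.smulSection_add {U : Opens X}
    (φ : LocalHom M (SheafOfModules.unit (ringCatSheaf O)) U) (n n' : N.val.obj (op U)) :
    φ.smulSection (n + n') = φ.smulSection n + φ.smulSection n' := LocalHom.ext (by
  funext V hV
  refine LinearMap.ext fun m => ?_
  rw [LocalHom.smulSection_app, map_add, smul_add]
  rfl)

lemma LocalHom.smulSection_smul {U : Opens X} (r : O.obj.obj (op U))
    (φ : LocalHom M (SheafOfModules.unit (ringCatSheaf O)) U) (n : N.val.obj (op U)) :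
    φ.smulSection (r • n) = r • φ.smulSection n := LocalHom.ext (by
  funext V hV
  refine LinearMap.ext fun m => ?_
  rw [LocalHom.smulSection_app, res_smul, smul_comm]
  rfl)

lemma LocalHom.sum_app {ι : Type*} (s : Finset ι) {U : Opens X} (φ : ι → LocalHom M N U)
    (V : Opens X) (hV : V ≤ U) (m : M.val.obj (op V)) :
    (∑ i ∈ s, φ i).app V hV m = ∑ i ∈ s, (φ i).app V hV m :=
  map_sum (AddMonoidHom.mk' (fun ψ : LocalHom M N U => ψ.app V hV m) fun _ _ => rfl) _ _

/-- The comparison morphism from the presheaf `dual M ⊗ N` to `Hom(M, N)`. -/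
def dualTensorComparison (M N : Modules O) : preTensor (dual M) N ⟶ underlying (sheafHom M N) :=
  preTensorLift (M := dual M) (P := sheafHom M N)
    (fun U => LinearMap.mk₂ (O.obj.obj (op U))
      (fun (φ : LocalHom M (SheafOfModules.unit (ringCatSheaf O)) U) n =>
        (φ.smulSection n : LocalHom M N U))
      LocalHom.add_smulSection LocalHom.smul_smulSection LocalHom.smulSection_add
      LocalHom.smulSection_smul)
    (fun U V h φ n => LocalHom.ext (by
      funext W hW
      refine LinearMap.ext fun m => ?_
      change (show O.obj.obj (op W) from LocalHom.app (show LocalHom M _ U from φ) W _ m) •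
        res N hW (res N h n) = (show O.obj.obj (op W) from LocalHom.app (show LocalHom M _ U from φ)
          W _ m) • res N _ n
      rw [res_res]))

/-- A linear form is the combination of the dual basis with its values on the sections. -/
lemma DualBasis.sum_smul_p {U : Opens X} (D : DualBasis M U)
    (φ : LocalHom M (SheafOfModules.unit (ringCatSheaf O)) U) :
    ∑ k, (show O.obj.obj (op U) from φ.app U le_rfl (D.t k)) • D.p k = φ :=
  LocalHom.ext (by
    funext V hV
    refine LinearMap.ext fun m => ?_
    rw [LocalHom.sum_app]
    refine Eq.trans ?_ (congrArg (φ.app V hV) (D.sum_smul V hV m)).symm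
    rw [map_sum]
    refine Finset.sum_congr rfl fun k _ => ?_
    rw [map_smul, φ.naturality]
    exact mul_comm (G := O.obj.obj (op V)) _ _)

/-- A local homomorphism is determined by its values on a dual basis. -/
lemma DualBasis.sum_smulSection {U : Opens X} (D : DualBasis M U) (Φ : LocalHom M N U) :
    ∑ k, (D.p k).smulSection (Φ.app U le_rfl (D.t k)) = Φ :=
  LocalHom.ext (by
    funext V hV
    refine LinearMap.ext fun m => ?_
    rw [LocalHom.sum_app]
    refine Eq.trans ?_ (congrArg (Φ.app V hV) (D.sum_smul V hV m)).symm
    rw [map_sum]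
    refine Finset.sum_congr rfl fun k _ => ?_
    rw [map_smul, Φ.naturality]
    rfl)

/-- The inverse is `Φ ↦ ∑ p k ⊗ Φ (t k)`. One composite is `DualBasis.sum_smulSection`, the other
reduces on pure tensors to `DualBasis.sum_smul_p`. -/
lemma DualBasis.bijective_dualTensorComparison {U : Opens X} (D : DualBasis M U) (N : Modules O) :
    Function.Bijective (preApp (M := dual M) (P := sheafHom M N) (dualTensorComparison M N) U) := by
  let c := preApp (M := dual M) (P := sheafHom M N) (dualTensorComparison M N) U
  let ev (k : D.ι) : (sheafHom M N).val.obj (op U) →+ N.val.obj (op U) :=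
    AddMonoidHom.mk' (fun Φ : LocalHom M N U => Φ.app U le_rfl (D.t k)) fun _ _ => rfl
  let p (k : D.ι) : (dual M).val.obj (op U) := D.p k
  have hc (Φ : LocalHom M N U) : c (∑ k, p k ⊗ₜ ev k Φ) = Φ := by
    rw [map_sum]
    exact D.sum_smulSection Φ
  refine ⟨Function.LeftInverse.injective (g := fun Φ => ∑ k, p k ⊗ₜ ev k Φ) fun x => ?_,
    fun Φ => ⟨_, hc Φ⟩⟩
  change ∑ k, p k ⊗ₜ ev k (c x) = x
  induction x using TensorProduct.induction_on with
  | zero => simp only [map_zero, TensorProduct.tmul_zero, Finset.sum_const_zero]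
  | tmul φ n =>
    let r (k : D.ι) : O.obj.obj (op U) := LocalHom.app (show LocalHom M _ U from φ) U le_rfl (D.t k)
    have h (k : D.ι) : ev k (c (φ ⊗ₜ n)) = r k • n :=
      congrArg (r k • ·) (res_refl N n)
    -- Moving the scalars `φ (t k)` to the left factor leaves the expansion of `φ` in the `p k`,
    -- tensored with `n`.
    simp only [h, ← TensorProduct.smul_tmul (R := O.obj.obj (op U)), ← TensorProduct.sum_tmul]
    exact congrArg (· ⊗ₜ n) (D.sum_smul_p φ)
  | add x y hx hy => simp only [map_add, TensorProduct.tmul_add, Finset.sum_add_distrib, hx, hy]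

/-- The morphism `underlying N ⟶ underlying N'` induced by a morphism of sheaves of modules. -/
abbrev underlyingMap {N N' : Modules O} (f : N ⟶ N') : underlying N ⟶ underlying N' :=
  (PresheafOfModules.restrictScalars (𝟙 (ringCatSheaf O).obj)).map f.val

/-- The morphism `M ⊗ N ⟶ M ⊗ N'` of presheaves induced by a morphism `N ⟶ N'`. -/
abbrev preTensorMap (M : Modules O) {N N' : Modules O} (f : N ⟶ N') :
    preTensor M N ⟶ preTensor M N' :=
  MonoidalCategory.whiskerLeft
    (C := PresheafOfModules.{u} (O.obj ⋙ forget₂ CommRingCat RingCat)) M.val f.val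

lemma smulSection_appHom {N' : Modules O} (f : N ⟶ N') {U : Opens X}
    (φ : LocalHom M (SheafOfModules.unit (ringCatSheaf O)) U) (n : N.val.obj (op U)) :
    φ.smulSection (appHom f U n) = appHom ((sheafHomFunctor M).map f) U (φ.smulSection n) := by
  refine LocalHom.ext ?_
  funext V hV
  refine LinearMap.ext fun m => ?_
  rw [LocalHom.smulSection_app, ← appHom_res, ← map_smul]
  rfl

lemma dualTensorComparison_naturality {N' : Modules O} (f : N ⟶ N') :
    preTensorMap (dual M) f ≫ dualTensorComparison M N' =
      dualTensorComparison M N ≫ underlyingMap ((sheafHomFunctor M).map f) :=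
  preApp_ext (M := dual M) (P := sheafHom M N') fun _ φ n => smulSection_appHom f φ n

/-- The comparison morphism from `dual M ⊗ N` to `Hom(M, N)`, naturally in `N`. -/
def dualTensorHom (M : Modules O) : tensorFunctor (dual M) ⟶ sheafHomFunctor M where
  app N := ((sheafifyAdj O).homEquiv (preTensor (dual M) N) (sheafHom M N)).symm
    (dualTensorComparison M N)
  naturality N N' f :=
    ((sheafifyAdj O).homEquiv_naturality_left_symm (Y := sheafHom M N') (preTensorMap (dual M) f)
      (dualTensorComparison M N')).symm.trans ((congrArg _
        (dualTensorComparison_naturality f)).trans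
      ((sheafifyAdj O).homEquiv_naturality_right_symm (X := preTensor (dual M) N)
        (Y := sheafHom M N) (Y' := sheafHom M N')
        (dualTensorComparison M N) ((sheafHomFunctor M).map f)))

/-- If `M` has local dual bases then `dual M ⊗ N` is isomorphic to `Hom(M, N)`. -/
lemma isIso_dualTensorHom (hM : ∀ x : X, ∃ U : Opens X, x ∈ U ∧ Nonempty (DualBasis M U)) :
    IsIso (dualTensorHom M) := by
  have (N : Modules O) : IsIso ((dualTensorHom M).app N) := by
    have h (x : X) : ∃ U : Opens X, x ∈ U ∧ ∀ V ≤ U,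
        Function.Bijective ((dualTensorComparison M N).app (op V)) := by
      obtain ⟨U, hx, ⟨D⟩⟩ := hM x
      exact ⟨U, hx, fun V hV => (D.restrict hV).bijective_dualTensorComparison N⟩
    exact isIso_sheafifyAdj_homEquiv_symm (dualTensorComparison M N)
      (isLocallyInjective_of_locally_injective _
        fun x => (h x).imp fun U hU => ⟨hU.1, fun V hV => (hU.2 V hV).1⟩)
      (isLocallySurjective_of_locally_surjective _
        fun x => (h x).imp fun U hU => ⟨hU.1, fun V hV => (hU.2 V hV).2⟩)
  exact NatIso.isIso_of_isIso_app _

/-! ### Ext as cohomology -/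

/-- Global sections of the sheaf of homomorphisms are morphisms. -/
def homLinearEquivLocalHom (M N : Modules O) :
    (M ⟶ N) ≃ₗ[O.obj.obj (op ⊤)] LocalHom M N ⊤ where
  toFun f := ⟨fun V _ => appHom f V, fun _ _ _ hW m => appHom_res f hW m⟩
  map_add' _ _ := rfl
  map_smul' _ _ := rfl
  invFun φ :=
    { val := PresheafOfModules.homMk
        { app := fun U => AddCommGrpCat.ofHom (φ.app U.unop le_top).toAddMonoidHom
          naturality := fun U V i => by
            ext (m : M.val.obj (op U.unop))
            exact φ.naturality U.unop V.unop le_top i.unop.le m }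
        (fun U a m => (φ.app U.unop le_top).map_smul a m) }
  left_inv _ := rfl
  right_inv _ := rfl

/-- The functor `Hom(M, -)` is the functor of global sections of the sheaf of homomorphisms. -/
def linearCoyonedaIso (M : Modules O) :
    (linearCoyoneda (O.obj.obj (op ⊤)) (Modules O)).obj (op M) ≅
      sheafHomFunctor M ⋙ globalSections O :=
  NatIso.ofComponents (fun N => LinearEquiv.toModuleIso (homLinearEquivLocalHom M N))
    fun _ => rfl

instance (M : Modules O) : (sheafHomFunctor M).Additive where
  map_add := appHom_ext fun _ _ => rfl

/-- On a ringed space, `Ext(F, -)` is the cohomology of `dual F ⊗ -` when `F` is locally free of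
finite rank. -/
theorem nonempty_ext_linearEquiv_cohomology {F : Modules O} (hF : IsLocallyFreeOfFiniteRank F)
    (G : Modules O) (q : ℕ) :
    Nonempty (Abelian.Ext F G q ≃ₗ[GlobalRing O] cohomology q (tensor (dual F) G)) := by
  have hF' := hF.exists_dualBasis
  have := isIso_dualTensorHom hF'
  let e := asIso (dualTensorHom F)
  have := preservesMonomorphisms_tensorFunctor hF'
  -- Limits are preserved by the sheaf Hom functor of `F`, colimits by `dual F ⊗ -`; the isomorphism
  -- `e` gives one functor both properties.
  have := (tensorAdjunction F).rightAdjoint_preservesLimits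
  have := (tensorAdjunction (dual F)).leftAdjoint_preservesColimits
  have : PreservesFiniteLimits (tensorFunctor (dual F)) :=
    preservesFiniteLimits_of_natIso e.symm
  have : (tensorFunctor (dual F)).Additive := Functor.additive_of_iso e.symm
  -- Flatness of `F` is used here: the right adjoint of a functor preserving monomorphisms preserves
  -- injectives.
  have := Functor.preservesInjectiveObjects_of_adjunction_of_preservesMonomorphisms
    (tensorAdjunction F)
  have : (tensorFunctor (dual F)).PreservesInjectiveObjects :=
    ⟨fun {I} _ => Injective.of_iso (e.symm.app I) ((sheafHomFunctor F).injective_obj I)⟩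
  exact nonempty_ext_linearEquiv_rightDerived (tensorFunctor (dual F)) (globalSections O)
    (linearCoyonedaIso F ≪≫ Functor.isoWhiskerRight e.symm _) G q

end

end RingedSpaceModules

theorem mainTheorem4 {E : Type*} [NormedAddCommGroup E] [NormedSpace ℂ E] [FiniteDimensional ℂ E]
    (M : Type) [TopologicalSpace M] [ChartedSpace E M] [IsManifold 𝓘(ℂ, E) ∞ M]
    (F G : Modules (holomorphicSheaf E M))
    (hF : IsLocallyFreeOfFiniteRank F) (hG : IsCoherent G) (q : ℕ) :
    Nonempty (Abelian.Ext F G q ≃ₗ[GlobalRing (holomorphicSheaf E M)]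
      cohomology q (tensor (dual F) G)) :=
  nonempty_ext_linearEquiv_cohomology hF G q
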